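/- Let $X$ be a non-empty compact metric space with metric $d$, let $T:X\to X$ be a homeomorphism, and let $\mu$ be a $T$-invariant regular Borel probability measure on $X$; let $\mathcal B$ be the Borel $\sigma$-algebra. A subsequence of $\mathbb N$ is a strictly increasing sequence of natural numbers. Let $A=(a_i)_{i\ge 1}$ be a subsequence of $\mathbb N$ such that $(X,T)$ is $\mu$-$A$-equicontinuous: for every $\tau>0$ there is a compact set $K\subset X$ with $\mu(K)>1-\tau$ such that for every $\epsilon>0$ there is $\delta>0$ with $$x,y\in K,\ d(x,y)<\delta\ \Longrightarrow\ d(T^{a_n}x,T^{a_n}y)<\epsilon\quad\text{for all } n\ge 1 .$$ Then the following hold. 1. For every subsequence $S=(s_i)_{i\ge1}$ of $A$, the sequence entropy of $(X,\mathcal B,\mu,T)$ along $S$ vanishes: $$h_\mu^S(T)=\sup_{\xi}\ \limsup_{n\to\infty}\frac1n H_\mu\Big(\bigvee_{i=1}^n T^{-s_i}\xi\Big)=0,$$ where the supremum is over all finite measurable partitions $\xi$ of $X$, and $H_\mu(\eta)=-\sum_{C\in\eta}\mu(C)\log\mu(C)$ (with $0\log 0=0$) for a finite measurable partition $\eta$.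 2. $(X,\mathcal B,\mu,T)$ is rigid: there is a subsequence $(t_k)$ of $\mathbb N$ such that $f\circ T^{t_k}\to f$ in $L^2(\mu)$ for all $f\in L^2(\mu)$. -/

import Mathlib

open MeasureTheory Filter Topology

namespace MeasureRigidity

/-- A subsequence of the natural numbers: a strictly increasing sequence of natural numbers
(its terms are listed as `a 0 < a 1 < a 2 < ⋯`). -/
def IsSubseqNat (a : ℕ → ℕ) : Prop := StrictMono a

/-- `s` is a subsequence of the sequence `a`. -/
def IsSubseqOf (s a : ℕ → ℕ) : Prop := ∃ φ : ℕ → ℕ, StrictMono φ ∧ s = a ∘ φ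

/-- The set `K` is `A`-equicontinuous for `A = {a 0 < a 1 < ⋯}`. -/
def EquicontinuousAlong {X : Type*} [MetricSpace X] (T : X → X) (a : ℕ → ℕ) (K : Set X) : Prop :=
  ∀ ε : ℝ, 0 < ε → ∃ δ : ℝ, 0 < δ ∧ ∀ x ∈ K, ∀ y ∈ K, dist x y < δ →
    ∀ n : ℕ, dist (T^[a n] x) (T^[a n] y) < ε

/-- `(X, T)` is `μ`-`A`-equicontinuous for `A = {a 0 < a 1 < ⋯}`. -/
def MeasureEquicontinuousAlong {X : Type*} [MetricSpace X] [MeasurableSpace X]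
    (T : X → X) (μ : Measure X) (a : ℕ → ℕ) : Prop :=
  ∀ τ : ℝ, 0 < τ → ∃ K : Set X, IsCompact K ∧ μ.real K > 1 - τ ∧ EquicontinuousAlong T a K

/-- An indexed family of sets is a measurable partition of `X`. Empty cells are allowed; they
contribute nothing to the entropy. -/
structure IsMeasurablePartition {X ι : Type*} [MeasurableSpace X] (ξ : ι → Set X) : Prop where
  measurableSet : ∀ i, MeasurableSet (ξ i)
  disjoint : Pairwise fun i j => Disjoint (ξ i) (ξ j)
  iUnion_eq : ⋃ i, ξ i = Set.univ

/-- The entropy `H_μ(ξ) = - ∑ μ(ξ i) log μ(ξ i)` of a finite partition, with `0 log 0 = 0`. -/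
noncomputable def partitionEntropy {X ι : Type*} [MeasurableSpace X] [Fintype ι]
    (μ : Measure X) (ξ : ι → Set X) : ℝ :=
  -∑ i, μ.real (ξ i) * Real.log (μ.real (ξ i))

/-- The join of the partitions `T^{-s 0} ξ, …, T^{-s (n-1)} ξ` given by the first `n` terms of `s`.
Its cells are the intersections `⋂ i < n, T^{-s i} (ξ (w i))`, indexed by words `w` of length `n`. -/
def joinAlong {X ι : Type*} (T : X → X) (s : ℕ → ℕ) (ξ : ι → Set X) (n : ℕ) :
    (Fin n → ι) → Set X :=
  fun w => ⋂ i : Fin n, T^[s i] ⁻¹' ξ (w i)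

/-- The sequence entropy `h_μ^S(T, ξ)` of a finite partition `ξ` along `S = {s 0 < s 1 < ⋯}`. -/
noncomputable def seqEntropyOf {X ι : Type*} [MeasurableSpace X] [Fintype ι]
    (T : X → X) (μ : Measure X) (s : ℕ → ℕ) (ξ : ι → Set X) : EReal :=
  limsup (fun n : ℕ => ((1 / (n : ℝ) * partitionEntropy μ (joinAlong T s ξ n) : ℝ) : EReal)) atTop

/-- The sequence entropy `h_μ^S(T)`: the supremum of `h_μ^S(T, ξ)` over all finite measurable
partitions `ξ`. -/
noncomputable def seqEntropy {X : Type*} [MeasurableSpace X]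
    (T : X → X) (μ : Measure X) (s : ℕ → ℕ) : EReal :=
  ⨆ (k : ℕ) (ξ : Fin k → Set X) (_ : IsMeasurablePartition ξ), seqEntropyOf T μ s ξ

/-- The measure preserving system is rigid: there is a strictly increasing sequence `t` of natural
numbers with `f ∘ T^{t k} → f` in `L²(μ)` for every complex-valued `f` in `L²(μ)`. -/
def IsRigid {X : Type*} [MeasurableSpace X] {T : X → X} {μ : Measure X}
    (hT : MeasurePreserving T μ μ) : Prop :=
  ∃ t : ℕ → ℕ, IsSubseqNat t ∧ ∀ f : Lp ℂ 2 μ,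
    Tendsto (fun k : ℕ => Lp.compMeasurePreserving (T^[t k]) (hT.iterate (t k)) f) atTop (𝓝 f)

end MeasureRigidity

/-!
The Koopman operator `U f = f ∘ T` is an isometry of `Lᵖ`. Equicontinuity along `a` on a compact
set `K` of almost full measure, together with the invariance of `μ`, which bounds the measure of
the set of points leaving `K` at a given time, shows that `{U ^ (a n) f | n}` is totally bounded
in `Lᵖ` for bounded continuous `f`, hence, by density, for every `f`.

Entropy: by total boundedness in `L¹`, each labelling `L ∘ T^(a n)` of the points by the cells of a
partition agrees, off a set of small measure, with one of finitely many reference labellings. Given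
these, every further coordinate of the join costs only little entropy, so the rate is `0`.

Rigidity: by the pigeonhole principle there are `m < n` with `U ^ (a n) f` close to `U ^ (a m) f`
simultaneously for finitely many `f`. Cancelling the isometry `U ^ (a m)` leaves the return time
`a n - a m`, and a diagonal argument over a countable dense set of `f` gives the sequence `t`.
-/

namespace MeasureRigidity

section TotallyBounded

variable {Y : Type*} [PseudoMetricSpace Y]

theorem totallyBounded_range_iff {ι : Type*} {u : ι → Y} :
    TotallyBounded (Set.range u) ↔
      ∀ ε > 0, ∃ F : Finset ι, ∀ i, ∃ j ∈ F, dist (u i) (u j) < ε := by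
  classical
  refine ⟨fun hu ε hε => ?_, fun h => Metric.totallyBounded_iff.2 fun ε hε => ?_⟩
  · obtain ⟨t, hts, htf, hcov⟩ := Metric.finite_approx_of_totallyBounded hu ε hε
    lift t to Finset Y using htf
    obtain ⟨F, -, rfl⟩ := Finset.subset_set_image_iff.1 (Set.image_univ (f := u) ▸ hts)
    exact ⟨F, fun i => by simpa using hcov (Set.mem_range_self i)⟩
  · obtain ⟨F, hF⟩ := h ε hε
    refine ⟨u '' F, F.finite_toSet.image u, ?_⟩
    rintro _ ⟨i, rfl⟩
    simpa using hF i

theorem totallyBounded_range_of_dense {ι Z : Type*} [PseudoMetricSpace Z] {U : ι → Y → Z}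
    (hU : ∀ i, Isometry (U i)) {s : Set Y} (hs : Dense s)
    (h : ∀ y ∈ s, TotallyBounded (Set.range fun i => U i y)) (y : Y) :
    TotallyBounded (Set.range fun i => U i y) := by
  refine totallyBounded_range_iff.2 fun ε hε => ?_
  obtain ⟨z, hz, hyz⟩ := hs.exists_dist_lt y (ε := ε / 3) (by positivity)
  obtain ⟨F, hF⟩ := totallyBounded_range_iff.1 (h z hz) (ε / 3) (by positivity)
  refine ⟨F, fun i => ?_⟩
  obtain ⟨j, hj, hij⟩ := hF i
  refine ⟨j, hj, ?_⟩
  calc dist (U i y) (U j y)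
      ≤ dist (U i y) (U i z) + dist (U i z) (U j z) + dist (U j z) (U j y) := dist_triangle4 ..
    _ = dist y z + dist (U i z) (U j z) + dist y z := by
      rw [(hU i).dist_eq, (hU j).dist_eq, dist_comm z y]
    _ < ε := by linarith

theorem exists_add_lt_forall_dist_lt {α : Type*} [Finite α] {u : α → ℕ → Y}
    (hu : ∀ j, TotallyBounded (Set.range (u j))) {ε : ℝ} (hε : 0 < ε) (N : ℕ) :
    ∃ m n, m + N < n ∧ ∀ j, dist (u j n) (u j m) < ε := by
  choose F hF using fun j => totallyBounded_range_iff.1 (hu j) (ε / 2) (by positivity)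
  choose c hcF hc using hF
  obtain ⟨w, hw⟩ := Finite.exists_infinite_fiber fun n j => (⟨c j n, hcF j n⟩ : F j)
  rw [Set.infinite_coe_iff] at hw
  obtain ⟨m, hm⟩ := hw.nonempty
  obtain ⟨n, hn, hmn⟩ := hw.exists_gt (m + N)
  refine ⟨m, n, hmn, fun j => ?_⟩
  have hcenter : c j n = c j m := congrArg Subtype.val (congrFun (hn.trans hm.symm) j)
  calc dist (u j n) (u j m) ≤ dist (u j n) (u j (c j m)) + dist (u j m) (u j (c j m)) :=
        dist_triangle_right ..
    _ < ε / 2 + ε / 2 := add_lt_add (hcenter ▸ hc j n) (hc j m)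
    _ = ε := add_halves ε

variable {U : Y → Y} {a : ℕ → ℕ}

theorem isometry_iterate (hU : Isometry U) (n : ℕ) : Isometry U^[n] := by
  induction n with
  | zero => exact isometry_id
  | succ n ih => exact ih.comp hU

theorem frequently_forall_dist_iterate_lt (hU : Isometry U) (ha : StrictMono a) {α : Type*}
    [Finite α] {y : α → Y} (hy : ∀ j, TotallyBounded (Set.range fun n => U^[a n] (y j)))
    {ε : ℝ} (hε : 0 < ε) : ∃ᶠ t in atTop, ∀ j, dist (U^[t] (y j)) (y j) < ε := by
  refine frequently_atTop.2 fun N => ?_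
  obtain ⟨m, n, hmn, hdist⟩ := exists_add_lt_forall_dist_lt hy hε N
  have hgap : n - m + a m ≤ a n := by
    simpa [Nat.sub_add_cancel (by omega : m ≤ n)] using ha.add_le_nat (n - m) m
  refine ⟨a n - a m, by omega, fun j => ?_⟩
  -- Cancel the isometry `U^[a m]` from `U^[a n] = U^[a m] ∘ U^[a n - a m]`.
  rw [← (isometry_iterate hU (a m)).dist_eq, ← Function.iterate_add_apply,
    Nat.add_sub_cancel' (by omega : a m ≤ a n)]
  exact hdist j

theorem exists_strictMono_tendsto_iterate [TopologicalSpace.SeparableSpace Y] (hU : Isometry U)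
    (ha : StrictMono a) (h : ∀ y, TotallyBounded (Set.range fun n => U^[a n] y)) :
    ∃ t : ℕ → ℕ, StrictMono t ∧ ∀ y, Tendsto (fun k => U^[t k] y) atTop (𝓝 y) := by
  rcases isEmpty_or_nonempty Y with hY | hY
  · exact ⟨id, strictMono_id, fun y => (hY.false y).elim⟩
  let g := TopologicalSpace.denseSeq Y
  obtain ⟨t, ht, htg⟩ := extraction_forall_of_frequently fun k : ℕ =>
    frequently_forall_dist_iterate_lt hU ha (fun j : Fin (k + 1) => h (g j))
      (Nat.one_div_pos_of_nat (α := ℝ) (n := k))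
  refine ⟨t, ht, fun y => Metric.tendsto_atTop.2 fun ε hε => ?_⟩
  obtain ⟨j, hyg⟩ := (TopologicalSpace.denseRange_denseSeq Y).exists_dist_lt y
    (ε := ε / 3) (by positivity)
  obtain ⟨N, hN⟩ := exists_nat_one_div_lt (ε := ε / 3) (by positivity)
  refine ⟨max j N, fun k hk => ?_⟩
  have hreturn : dist (U^[t k] (g j)) (g j) < ε / 3 :=
    (htg k ⟨j, by omega⟩).trans_le ((Nat.one_div_le_one_div (by omega)).trans hN.le)
  calc dist (U^[t k] y) y
      ≤ dist (U^[t k] y) (U^[t k] (g j)) + dist (U^[t k] (g j)) (g j) + dist (g j) y :=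
        dist_triangle4 ..
    _ = dist y (g j) + dist (U^[t k] (g j)) (g j) + dist y (g j) := by
      rw [(isometry_iterate hU (t k)).dist_eq, dist_comm (g j) y]
    _ < ε := by linarith

end TotallyBounded

section Lp

theorem exists_pos_mul_rpow_lt (M : ℝ) {r ε : ℝ} (hr : 0 < r) (hε : 0 < ε) :
    ∃ τ > 0, M * τ ^ r < ε := by
  have hcont : Continuous fun τ : ℝ => M * τ ^ r :=
    continuous_const.mul (continuous_id.rpow_const fun _ => .inr hr.le)
  have hsmall : ∀ᶠ τ in 𝓝 (0 : ℝ), M * τ ^ r < ε :=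
    hcont.continuousAt.eventually_lt continuousAt_const (by simpa [hr.ne'] using hε)
  obtain ⟨τ, hτ, hlt⟩ :=
    ((eventually_mem_nhdsWithin (s := Set.Ioi 0)).and
      (hsmall.filter_mono nhdsWithin_le_nhds)).exists
  exact ⟨τ, hτ, hlt⟩

variable {X E : Type*} [MeasurableSpace X] [NormedAddCommGroup E] {p : ENNReal} {T : X → X}
  {μ : Measure X}

theorem coeFn_iterate_compMeasurePreserving
    (hT : MeasurePreserving T μ μ) {f : X → E} {F : Lp E p μ} (hF : F =ᵐ[μ] f) (n : ℕ) :
    (Lp.compMeasurePreserving T hT)^[n] F =ᵐ[μ] f ∘ T^[n] := by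
  rw [Lp.compMeasurePreserving_iterate]
  exact (Lp.coeFn_compMeasurePreserving F (hT.iterate n)).trans
    ((hT.iterate n).quasiMeasurePreserving.ae_eq_comp hF)

theorem norm_le_add_mul_measureReal_rpow [Fact (1 ≤ p)]
    [IsProbabilityMeasure μ] (hp : p ≠ ⊤) {F : Lp E p μ} {s : Set X} {ε M : ℝ} (hε : 0 ≤ ε)
    (hM : 0 ≤ M) (hFε : ∀ᵐ x ∂μ, x ∉ s → ‖F x‖ ≤ ε) (hFM : ∀ᵐ x ∂μ, ‖F x‖ ≤ M) :
    ‖F‖ ≤ ε + M * μ.real s ^ (1 / p.toReal) := by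
  have hp0 : p ≠ 0 := (zero_lt_one.trans_le Fact.out).ne'
  let C : Lp ℝ p μ := Lp.const p μ ε
  let I : Lp ℝ p μ :=
    indicatorConstLp p (measurableSet_toMeasurable μ s) (measure_ne_top μ _) M
  have hbound : ∀ᵐ x ∂μ, ‖F x‖ ≤ ‖(C + I) x‖ := by
    filter_upwards [hFε, hFM, Lp.coeFn_add C I, Lp.coeFn_const p μ ε,
      indicatorConstLp_coeFn (p := p) (hs := measurableSet_toMeasurable μ s)
        (hμs := measure_ne_top μ _) (c := M)] with x hxε hxM hadd hconst hind
    rw [hadd, Pi.add_apply, hconst, hind]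
    refine le_trans ?_ (le_abs_self _)
    by_cases hx : x ∈ toMeasurable μ s
    · simpa [hx] using hxM.trans (le_add_of_nonneg_left hε)
    · simpa [hx] using hxε fun hxs => hx (subset_toMeasurable μ s hxs)
  have hC : ‖C‖ = ε := by
    rw [Lp.norm_const p μ ε hp0, probReal_univ, Real.one_rpow, mul_one, Real.norm_of_nonneg hε]
  have hI : ‖I‖ = M * μ.real s ^ (1 / p.toReal) := by
    rw [norm_indicatorConstLp hp0 hp, Real.norm_of_nonneg hM, measureReal_def,
      measure_toMeasurable, measureReal_def]
  calc ‖F‖ ≤ ‖C + I‖ := Lp.norm_le_norm_of_ae_le hbound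
    _ ≤ ‖C‖ + ‖I‖ := norm_add_le C I
    _ = ε + M * μ.real s ^ (1 / p.toReal) := by rw [hC, hI]

end Lp

section Orbit

variable {X E : Type*} [MetricSpace X] {T : X → X} {a : ℕ → ℕ}

theorem EquicontinuousAlong.exists_finset_dist_lt {K : Set X}
    (hK : EquicontinuousAlong T a K) (hKc : IsCompact K) [PseudoMetricSpace E]
    [ProperSpace E] (f : BoundedContinuousFunction X E)
    {ε : ℝ} (hε : 0 < ε) :
    ∃ F : Finset ℕ, ∀ n, ∃ m ∈ F, ∀ x ∈ K, T^[a n] x ∈ K → T^[a m] x ∈ K →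
      dist (f (T^[a n] x)) (f (T^[a m] x)) < ε := by
  obtain ⟨η, hη, hf⟩ := Metric.mem_uniformity_dist.1
    (hKc.uniformContinuousAt_of_continuousAt f (fun x _ => f.continuous.continuousAt)
      (Metric.dist_mem_uniformity (ε := ε / 3) (by positivity)))
  obtain ⟨δ, hδ, hT⟩ := hK η hη
  obtain ⟨t, htK, htf, hcov⟩ := Metric.finite_approx_of_totallyBounded hKc.totallyBounded δ hδ
  have := htf.fintype
  -- By equicontinuity it suffices to control `f ∘ T^[a n]` on a finite `δ`-net `t` of `K`.
  have hnet : TotallyBounded (Set.range fun n (y : t) => f (T^[a n] y)) := by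
    refine (isCompact_univ_pi fun _ => f.isBounded_range.isCompact_closure).totallyBounded.subset ?_
    rintro _ ⟨n, rfl⟩ y -
    exact subset_closure (Set.mem_range_self _)
  obtain ⟨F, hF⟩ := totallyBounded_range_iff.1 hnet (ε / 3) (by positivity)
  refine ⟨F, fun n => ?_⟩
  obtain ⟨m, hm, hnm⟩ := hF n
  refine ⟨m, hm, fun x hx hxn hxm => ?_⟩
  obtain ⟨y, hy, hxy⟩ := Set.mem_iUnion₂.1 (hcov hx)
  have hxy_n : dist (f (T^[a n] x)) (f (T^[a n] y)) < ε / 3 :=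
    hf (hT x hx y (htK hy) hxy n) hxn
  have hxy_m : dist (f (T^[a m] x)) (f (T^[a m] y)) < ε / 3 :=
    hf (hT x hx y (htK hy) hxy m) hxm
  have hnm_y : dist (f (T^[a n] y)) (f (T^[a m] y)) < ε / 3 :=
    (dist_pi_lt_iff (by positivity)).1 hnm ⟨y, hy⟩
  have := dist_triangle4_right (f (T^[a n] x)) (f (T^[a m] x)) (f (T^[a n] y)) (f (T^[a m] y))
  linarith

variable [MeasurableSpace X] {μ : Measure X}

theorem MeasureEquicontinuousAlong.comp (h : MeasureEquicontinuousAlong T μ a) (φ : ℕ → ℕ) :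
    MeasureEquicontinuousAlong T μ (a ∘ φ) := by
  intro τ hτ
  obtain ⟨K, hKc, hKμ, hK⟩ := h τ hτ
  refine ⟨K, hKc, hKμ, fun ε hε => ?_⟩
  obtain ⟨δ, hδ, hT⟩ := hK ε hε
  exact ⟨δ, hδ, fun x hx y hy hxy n => hT x hx y hy hxy (φ n)⟩

variable [BorelSpace X] [IsProbabilityMeasure μ]

theorem MeasureEquicontinuousAlong.exists_finset_measureReal_le
    (hT : MeasurePreserving T μ μ) (hequi : MeasureEquicontinuousAlong T μ a)
    [PseudoMetricSpace E] [ProperSpace E]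
    (f : BoundedContinuousFunction X E) {ε τ : ℝ} (hε : 0 < ε) (hτ : 0 < τ) :
    ∃ F : Finset ℕ, ∀ n, ∃ m ∈ F,
      μ.real {x | ε ≤ dist (f (T^[a n] x)) (f (T^[a m] x))} ≤ τ := by
  obtain ⟨K, hKc, hKμ, hK⟩ := hequi (τ / 3) (by positivity)
  obtain ⟨F, hF⟩ := hK.exists_finset_dist_lt hKc f hε
  refine ⟨F, fun n => ?_⟩
  obtain ⟨m, hm, hnm⟩ := hF n
  refine ⟨m, hm, ?_⟩
  have hKτ : μ.real Kᶜ ≤ τ / 3 := by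
    rw [probReal_compl_eq_one_sub hKc.measurableSet]
    linarith
  have hpre (k : ℕ) : μ.real (T^[k] ⁻¹' Kᶜ) = μ.real Kᶜ :=
    (hT.iterate k).measureReal_preimage hKc.measurableSet.compl.nullMeasurableSet
  have hsub : {x | ε ≤ dist (f (T^[a n] x)) (f (T^[a m] x))} ⊆
      Kᶜ ∪ (T^[a n] ⁻¹' Kᶜ ∪ T^[a m] ⁻¹' Kᶜ) := by
    intro x hx
    by_contra hxK
    simp only [Set.mem_union, Set.mem_preimage, Set.mem_compl_iff, not_or, not_not] at hxK
    exact (hnm x hxK.1 hxK.2.1 hxK.2.2).not_ge hx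
  calc μ.real {x | ε ≤ dist (f (T^[a n] x)) (f (T^[a m] x))}
      ≤ μ.real (Kᶜ ∪ (T^[a n] ⁻¹' Kᶜ ∪ T^[a m] ⁻¹' Kᶜ)) := measureReal_mono hsub
    _ ≤ μ.real Kᶜ + (μ.real (T^[a n] ⁻¹' Kᶜ) + μ.real (T^[a m] ⁻¹' Kᶜ)) :=
      (measureReal_union_le _ _).trans (by gcongr; exact measureReal_union_le _ _)
    _ ≤ τ := by rw [hpre, hpre]; linarith

theorem MeasureEquicontinuousAlong.totallyBounded_orbit_toLp [NormedAddCommGroup E]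
    [ProperSpace E] [NormedSpace ℝ E] {p : ENNReal} [Fact (1 ≤ p)]
    (hT : MeasurePreserving T μ μ)
    (hequi : MeasureEquicontinuousAlong T μ a) (hp : p ≠ ⊤) (f : BoundedContinuousFunction X E) :
    TotallyBounded (Set.range fun n =>
      (Lp.compMeasurePreserving T hT)^[a n] (f.toLp p μ ℝ)) := by
  refine totallyBounded_range_iff.2 fun ε hε => ?_
  have hp0 : 0 < p.toReal := ENNReal.toReal_pos (zero_lt_one.trans_le Fact.out).ne' hp
  obtain ⟨τ, hτ, hτε⟩ := exists_pos_mul_rpow_lt (2 * ‖f‖) (one_div_pos.2 hp0) (half_pos hε)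
  obtain ⟨F, hF⟩ := hequi.exists_finset_measureReal_le hT f (half_pos hε) hτ
  refine ⟨F, fun n => ?_⟩
  obtain ⟨m, hm, hnm⟩ := hF n
  refine ⟨m, hm, ?_⟩
  set U := Lp.compMeasurePreserving (E := E) (p := p) T hT
  have hnorm : ∀ᵐ x ∂μ, ‖(U^[a n] (f.toLp p μ ℝ) - U^[a m] (f.toLp p μ ℝ) : Lp E p μ) x‖ =
      dist (f (T^[a n] x)) (f (T^[a m] x)) := by
    have hcoe := coeFn_iterate_compMeasurePreserving hT (f.coeFn_toLp (p := p) (μ := μ) ℝ)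
    filter_upwards [Lp.coeFn_sub (U^[a n] (f.toLp p μ ℝ)) (U^[a m] (f.toLp p μ ℝ)),
      hcoe (a n), hcoe (a m)] with x hsub hn hm
    rw [hsub, Pi.sub_apply, hn, hm, dist_eq_norm, Function.comp_apply, Function.comp_apply]
  calc dist (U^[a n] (f.toLp p μ ℝ)) (U^[a m] (f.toLp p μ ℝ))
      = ‖U^[a n] (f.toLp p μ ℝ) - U^[a m] (f.toLp p μ ℝ)‖ := dist_eq_norm _ _
    _ ≤ ε / 2 + 2 * ‖f‖ *
          μ.real {x | ε / 2 ≤ dist (f (T^[a n] x)) (f (T^[a m] x))} ^ (1 / p.toReal) := by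
      refine norm_le_add_mul_measureReal_rpow hp (half_pos hε).le (by positivity) ?_ ?_
      · filter_upwards [hnorm] with x hx hclose
        exact hx.le.trans (not_le.1 hclose).le
      · filter_upwards [hnorm] with x hx
        exact hx.le.trans (f.dist_le_two_norm _ _)
    _ ≤ ε / 2 + 2 * ‖f‖ * τ ^ (1 / p.toReal) := by gcongr
    _ < ε := by linarith

theorem MeasureEquicontinuousAlong.totallyBounded_orbit [NormedAddCommGroup E]
    [ProperSpace E] [NormedSpace ℝ E] {p : ENNReal} [Fact (1 ≤ p)]
    (hT : MeasurePreserving T μ μ)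
    (hequi : MeasureEquicontinuousAlong T μ a) (hp : p ≠ ⊤) (f : Lp E p μ) :
    TotallyBounded (Set.range fun n => (Lp.compMeasurePreserving T hT)^[a n] f) := by
  refine totallyBounded_range_of_dense
    (fun n => isometry_iterate (Lp.isometry_compMeasurePreserving (E := E) (p := p) hT) (a n))
    (BoundedContinuousFunction.toLp_denseRange E μ ℝ hp) ?_ f
  rintro _ ⟨f, rfl⟩
  exact hequi.totallyBounded_orbit_toLp hT hp f

theorem MeasureEquicontinuousAlong.isRigid [SecondCountableTopology X]
    (hT : MeasurePreserving T μ μ) (hequi : MeasureEquicontinuousAlong T μ a)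
    (ha : IsSubseqNat a) : IsRigid hT := by
  have : Fact ((2 : ENNReal) ≠ ⊤) := ⟨ENNReal.ofNat_ne_top⟩
  simpa only [IsRigid, IsSubseqNat, Lp.compMeasurePreserving_iterate] using
    exists_strictMono_tendsto_iterate
      (Lp.isometry_compMeasurePreserving (E := ℂ) (p := 2) hT) ha
      (hequi.totallyBounded_orbit (E := ℂ) (p := 2) hT ENNReal.ofNat_ne_top)

end Orbit

section Entropy

theorem negMulLog_sum_le {ι : Type*} (s : Finset ι) {p : ι → ℝ} (hp : ∀ i ∈ s, 0 ≤ p i) :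
    Real.negMulLog (∑ i ∈ s, p i) ≤ ∑ i ∈ s, Real.negMulLog (p i) := by
  simp only [Real.negMulLog, neg_mul, Finset.sum_neg_distrib, Finset.sum_mul, neg_le_neg_iff]
  refine Finset.sum_le_sum fun i hi => ?_
  rcases (hp i hi).eq_or_lt with h0 | h0
  · simp [← h0]
  · gcongr
    exact Finset.single_le_sum hp hi

theorem negMulLog_le_neg_mul_log_mul {p q r : ℝ} (hr : 0 ≤ r) (hrp : r ≤ p) (hrq : r ≤ q) :
    Real.negMulLog r ≤ -(r * Real.log p) - r * Real.log q + (p * q - r) := by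
  rcases hr.eq_or_lt with rfl | hr
  · simpa using mul_nonneg hrp hrq
  have hp := hr.trans_le hrp
  have hq := hr.trans_le hrq
  have hlog := mul_le_mul_of_nonneg_left
    (Real.log_le_sub_one_of_pos (div_pos (mul_pos hp hq) hr)) hr.le
  rw [Real.log_div (mul_pos hp hq).ne' hr.ne', Real.log_mul hp.ne' hq.ne', mul_sub_one,
    mul_div_cancel₀ _ hr.ne'] at hlog
  rw [Real.negMulLog]
  linarith

theorem sum_negMulLog_le_add_marginals {ι κ : Type*} [Fintype ι] [Fintype κ] {r : ι → κ → ℝ}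
    (hr : ∀ i j, 0 ≤ r i j) (hr1 : ∑ i, ∑ j, r i j = 1) :
    ∑ i, ∑ j, Real.negMulLog (r i j) ≤
      ∑ i, Real.negMulLog (∑ j, r i j) + ∑ j, Real.negMulLog (∑ i, r i j) := by
  let p : ι → ℝ := fun i => ∑ j, r i j
  let q : κ → ℝ := fun j => ∑ i, r i j
  have hp1 : ∑ i, p i = 1 := hr1
  have hq1 : ∑ j, q j = 1 := Finset.sum_comm.trans hr1
  have hrp (i j) : r i j ≤ p i :=
    Finset.single_le_sum (f := fun j => r i j) (fun j _ => hr i j) (Finset.mem_univ j)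
  have hrq (i j) : r i j ≤ q j :=
    Finset.single_le_sum (f := fun i => r i j) (fun i _ => hr i j) (Finset.mem_univ i)
  have hrow : ∑ i, ∑ j, r i j * Real.log (p i) = ∑ i, p i * Real.log (p i) := by
    simp only [← Finset.sum_mul, p]
  have hcol : ∑ i, ∑ j, r i j * Real.log (q j) = ∑ j, q j * Real.log (q j) := by
    rw [Finset.sum_comm]
    simp only [← Finset.sum_mul, q]
  have hmass : ∑ i, ∑ j, p i * q j = 1 := by rw [← Finset.sum_mul_sum, hp1, hq1, one_mul]
  calc ∑ i, ∑ j, Real.negMulLog (r i j)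
      ≤ ∑ i, ∑ j, (-(r i j * Real.log (p i)) - r i j * Real.log (q j) + (p i * q j - r i j)) := by
        gcongr with i _ j _
        exact negMulLog_le_neg_mul_log_mul (hr i j) (hrp i j) (hrq i j)
    _ = -∑ i, p i * Real.log (p i) - ∑ j, q j * Real.log (q j) := by
        simp only [Finset.sum_add_distrib, Finset.sum_sub_distrib, Finset.sum_neg_distrib,
          hrow, hcol, hmass, hr1, sub_self, add_zero]
    _ = ∑ i, Real.negMulLog (p i) + ∑ j, Real.negMulLog (q j) := by
        simp only [Real.negMulLog, neg_mul, Finset.sum_neg_distrib, sub_eq_add_neg]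

variable {X : Type*} [MeasurableSpace X] {μ : Measure X}

theorem measureReal_comp_fiber [IsFiniteMeasure μ] {ι κ : Type*} [Fintype ι] [MeasurableSpace ι]
    [MeasurableSingletonClass ι] [DecidableEq κ] {f : X → ι} (hf : Measurable f) (φ : ι → κ)
    (k : κ) :
    μ.real ((fun x => φ (f x)) ⁻¹' {k}) = ∑ i with φ i = k, μ.real (f ⁻¹' {i}) := by
  have hpre : (fun x => φ (f x)) ⁻¹' {k} = f ⁻¹' ↑({i | φ i = k} : Finset ι) := by
    ext x
    simp
  rw [hpre, sum_measureReal_preimage_singleton _ fun i _ => hf (measurableSet_singleton i)]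

/-- The Shannon entropy of a finite-valued random variable `f`, that is, the entropy of the
partition of `X` into the fibres of `f`. Labelling the cells of a partition by the values of a
function turns joins into pairings and coarsenings into compositions. -/
noncomputable def fiberEntropy {ι : Type*} [Fintype ι] (μ : Measure X) (f : X → ι) : ℝ :=
  ∑ i, Real.negMulLog (μ.real (f ⁻¹' {i}))

theorem fiberEntropy_eq_zero_of_subsingleton [IsProbabilityMeasure μ] {ι : Type*} [Fintype ι]
    [Subsingleton ι] (f : X → ι) : fiberEntropy μ f = 0 := by
  refine Finset.sum_eq_zero fun i _ => ?_
  have huniv : f ⁻¹' {i} = Set.univ := Set.eq_univ_of_forall fun _ => Subsingleton.elim _ _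
  rw [huniv, probReal_univ, Real.negMulLog_one]

variable [IsProbabilityMeasure μ]

theorem fiberEntropy_nonneg {ι : Type*} [Fintype ι] (f : X → ι) : 0 ≤ fiberEntropy μ f :=
  Finset.sum_nonneg fun _ _ => Real.negMulLog_nonneg measureReal_nonneg measureReal_le_one

variable {ι κ : Type*} [Fintype ι] [MeasurableSpace ι] [MeasurableSingletonClass ι]

theorem fiberEntropy_comp_le [Fintype κ] {f : X → ι} (hf : Measurable f) (φ : ι → κ) :
    fiberEntropy μ (fun x => φ (f x)) ≤ fiberEntropy μ f := by
  classical
  calc fiberEntropy μ (fun x => φ (f x))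
      = ∑ k, Real.negMulLog (∑ i with φ i = k, μ.real (f ⁻¹' {i})) := by
        simp only [fiberEntropy, measureReal_comp_fiber hf]
    _ ≤ ∑ k, ∑ i with φ i = k, Real.negMulLog (μ.real (f ⁻¹' {i})) := by
        gcongr
        exact negMulLog_sum_le _ fun _ _ => measureReal_nonneg
    _ = fiberEntropy μ f := Finset.sum_fiberwise ..

theorem fiberEntropy_prodMk_le [Fintype κ] [MeasurableSpace κ] [MeasurableSingletonClass κ]
    {f : X → ι} {g : X → κ} (hf : Measurable f) (hg : Measurable g) :
    fiberEntropy μ (fun x => (f x, g x)) ≤ fiberEntropy μ f + fiberEntropy μ g := by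
  classical
  let r : ι → κ → ℝ := fun i j => μ.real ((fun x => (f x, g x)) ⁻¹' {(i, j)})
  have hrow (i) : μ.real (f ⁻¹' {i}) = ∑ j, r i j := by
    rw [measureReal_comp_fiber (hf.prodMk hg) Prod.fst]
    simp [Finset.sum_filter, Fintype.sum_prod_type_right, r]
  have hcol (j) : μ.real (g ⁻¹' {j}) = ∑ i, r i j := by
    rw [measureReal_comp_fiber (hf.prodMk hg) Prod.snd]
    simp [Finset.sum_filter, Fintype.sum_prod_type, r]
  have htotal : ∑ i, ∑ j, r i j = 1 := by
    simp_rw [← hrow]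
    simpa using sum_measureReal_preimage_singleton (μ := μ) Finset.univ
      fun i _ => hf (measurableSet_singleton i)
  calc fiberEntropy μ (fun x => (f x, g x)) = ∑ i, ∑ j, Real.negMulLog (r i j) :=
        Fintype.sum_prod_type _
    _ ≤ ∑ i, Real.negMulLog (∑ j, r i j) + ∑ j, Real.negMulLog (∑ i, r i j) :=
        sum_negMulLog_le_add_marginals (fun _ _ => measureReal_nonneg) htotal
    _ = fiberEntropy μ f + fiberEntropy μ g := by simp only [fiberEntropy, hrow, hcol]

theorem fiberEntropy_pi_le_sum {n : ℕ} {f : Fin n → X → ι} (hf : ∀ i, Measurable (f i)) :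
    fiberEntropy μ (fun x i => f i x) ≤ ∑ i, fiberEntropy μ (f i) := by
  induction n with
  | zero => rw [fiberEntropy_eq_zero_of_subsingleton, Finset.univ_eq_empty, Finset.sum_empty]
  | succ n ih =>
    have hinit : Measurable fun x (i : Fin n) => f i.castSucc x :=
      measurable_pi_lambda _ fun i => hf i.castSucc
    let snoc : (Fin n → ι) × ι → Fin (n + 1) → ι := fun w => Fin.snoc w.1 w.2
    have hsnoc : (fun x i => f i x) =
        fun x => snoc (fun i : Fin n => f i.castSucc x, f (Fin.last n) x) :=
      funext fun x => (Fin.snoc_init_self fun i => f i x).symm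
    calc fiberEntropy μ (fun x i => f i x)
        ≤ fiberEntropy μ (fun x => (fun i : Fin n => f i.castSucc x, f (Fin.last n) x)) :=
          hsnoc ▸ fiberEntropy_comp_le (hinit.prodMk (hf _)) snoc
      _ ≤ fiberEntropy μ (fun x (i : Fin n) => f i.castSucc x) + fiberEntropy μ (f (Fin.last n)) :=
          fiberEntropy_prodMk_le hinit (hf _)
      _ ≤ ∑ i, fiberEntropy μ (f i) := by
          rw [Fin.sum_univ_castSucc]
          gcongr
          exact ih fun i => hf i.castSucc

/- The group structure on `ι` is a coding device: `f i` is recovered from the reference label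
`g (c i)` and the difference, which is constantly `0` where the two labels agree. -/
theorem fiberEntropy_pi_le_add_sum_sub [AddGroup ι] {β : Type*} [Fintype β] [DecidableEq β]
    {n : ℕ} {f : Fin n → X → ι} {g : β → X → ι} (hf : ∀ i, Measurable (f i))
    (hg : ∀ b, Measurable (g b)) (c : Fin n → β) :
    fiberEntropy μ (fun x i => f i x) ≤
      fiberEntropy μ (fun x b => g b x) + ∑ i, fiberEntropy μ (fun x => f i x - g (c i) x) := by
  have hg' : Measurable fun x b => g b x := measurable_pi_lambda _ hg
  have hsub (i) : Measurable fun x => f i x - g (c i) x :=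
    (Measurable.of_discrete (f := fun w : ι × ι => w.1 - w.2)).comp ((hf i).prodMk (hg (c i)))
  have hsub' : Measurable fun x i => f i x - g (c i) x := measurable_pi_lambda _ hsub
  calc fiberEntropy μ (fun x i => f i x)
      ≤ fiberEntropy μ (fun x => (fun b => g b x, fun i => f i x - g (c i) x)) := by
        simpa only [sub_add_cancel] using fiberEntropy_comp_le (hg'.prodMk hsub')
          fun w : (β → ι) × (Fin n → ι) => fun i => w.2 i + w.1 (c i)
    _ ≤ fiberEntropy μ (fun x b => g b x) + fiberEntropy μ (fun x i => f i x - g (c i) x) :=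
        fiberEntropy_prodMk_le hg' hsub'
    _ ≤ _ := by
        gcongr
        exact fiberEntropy_pi_le_sum hsub

theorem exists_fiberEntropy_le_of_measureReal_ne_lt (μ : Measure X) [IsProbabilityMeasure μ]
    (i₀ : ι) {ε : ℝ} (hε : 0 < ε) :
    ∃ δ > 0, ∀ f : X → ι, Measurable f → μ.real {x | f x ≠ i₀} < δ → fiberEntropy μ f ≤ ε := by
  classical
  let H : (ι → ℝ) → ℝ := fun p => ∑ i, Real.negMulLog (p i)
  have hH : Continuous H :=
    continuous_finsetSum _ fun i _ => Real.continuous_negMulLog.comp (continuous_apply i)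
  have hH0 : H (Pi.single i₀ 1) = 0 :=
    Finset.sum_eq_zero fun i _ => by by_cases h : i = i₀ <;> simp [h]
  obtain ⟨δ, hδ, hHδ⟩ := Metric.continuousAt_iff.1 (hH.continuousAt (x := Pi.single i₀ 1)) ε hε
  refine ⟨δ, hδ, fun f hf hfδ => ?_⟩
  have hdist : dist (fun i => μ.real (f ⁻¹' {i})) (Pi.single i₀ 1) < δ := by
    refine (dist_pi_lt_iff hδ).2 fun i => ?_
    rw [Real.dist_eq]
    rcases eq_or_ne i i₀ with rfl | hi
    · have hcompl : {x | f x ≠ i} = (f ⁻¹' {i})ᶜ := rfl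
      rw [hcompl, probReal_compl_eq_one_sub (hf (measurableSet_singleton i))] at hfδ
      rwa [Pi.single_eq_same, abs_sub_comm, abs_of_nonneg (sub_nonneg.2 measureReal_le_one)]
    · rw [Pi.single_eq_of_ne hi, sub_zero, abs_of_nonneg measureReal_nonneg]
      exact (measureReal_mono fun x hx => hx.trans_ne hi).trans_lt hfδ
  have hlt := hHδ hdist
  rw [hH0, Real.dist_0_eq_abs] at hlt
  exact (le_abs_self _).trans hlt.le

end Entropy

section SequenceEntropy

theorem tendsto_one_div_mul_of_forall_le {u : ℕ → ℝ} (hu : ∀ n, 0 ≤ u n)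
    (h : ∀ ε > 0, ∃ C, ∀ n : ℕ, u n ≤ C + n * ε) :
    Tendsto (fun n : ℕ => 1 / (n : ℝ) * u n) atTop (𝓝 0) := by
  refine Metric.tendsto_atTop'.2 fun ε hε => ?_
  obtain ⟨C, hC⟩ := h (ε / 2) (half_pos hε)
  obtain ⟨N, hN⟩ := exists_nat_gt (C / (ε / 2))
  refine ⟨N, fun n hn => ?_⟩
  have hn0 : (0 : ℝ) < n := Nat.cast_pos.2 (Nat.zero_lt_of_lt hn)
  have hCn : C < n * (ε / 2) :=
    ((div_lt_iff₀ (half_pos hε)).1 hN).trans (by gcongr)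
  rw [Real.dist_0_eq_abs, abs_of_nonneg (mul_nonneg (by positivity) (hu n)), one_div_mul_eq_div,
    div_lt_iff₀ hn0]
  linarith [hC n]

variable {X : Type*} [MeasurableSpace X] {μ : Measure X}

theorem isMeasurablePartition_univ {ι : Type*} [Nonempty ι] [Subsingleton ι] :
    IsMeasurablePartition fun _ : ι => (Set.univ : Set X) where
  measurableSet _ := .univ
  disjoint i j hij := (hij (Subsingleton.elim i j)).elim
  iUnion_eq := Set.iUnion_const _

theorem IsMeasurablePartition.exists_measurable_label {ι : Type*} [Countable ι]
    [MeasurableSpace ι] {ξ : ι → Set X} (hξ : IsMeasurablePartition ξ) :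
    ∃ L : X → ι, Measurable L ∧ ∀ i, L ⁻¹' {i} = ξ i := by
  choose L hL using fun x => Set.mem_iUnion.1 (hξ.iUnion_eq.symm ▸ Set.mem_univ x)
  have hfiber (i) : L ⁻¹' {i} = ξ i := by
    refine Set.Subset.antisymm (fun x hx => hx ▸ hL x) fun x hx => ?_
    by_contra hne
    exact Set.disjoint_left.1 (hξ.disjoint hne) (hL x) hx
  exact ⟨L, measurable_to_countable' fun i => hfiber i ▸ hξ.measurableSet i, hfiber⟩

theorem partitionEntropy_joinAlong {ι : Type*} [Fintype ι] {ξ : ι → Set X} {L : X → ι}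
    (hL : ∀ i, L ⁻¹' {i} = ξ i) (T : X → X) (s : ℕ → ℕ) (n : ℕ) :
    partitionEntropy μ (joinAlong T s ξ n) = fiberEntropy μ fun x (i : Fin n) => L (T^[s i] x) := by
  have hcell (w : Fin n → ι) :
      joinAlong T s ξ n w = (fun x (i : Fin n) => L (T^[s i] x)) ⁻¹' {w} := by
    ext x
    simp [joinAlong, ← hL, funext_iff]
  simp only [partitionEntropy, fiberEntropy, hcell, Real.negMulLog, neg_mul,
    Finset.sum_neg_distrib]

theorem measureReal_ne_le_dist [IsFiniteMeasure μ] {f g : X → ℕ} {F G : Lp ℝ 1 μ}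
    (hF : F =ᵐ[μ] fun x => (f x : ℝ)) (hG : G =ᵐ[μ] fun x => (g x : ℝ)) :
    μ.real {x | f x ≠ g x} ≤ dist F G := by
  have hgap : ∀ᵐ x ∂μ, f x ≠ g x → 1 ≤ ‖(F - G) x‖ := by
    filter_upwards [hF, hG, Lp.coeFn_sub F G] with x hFx hGx hsub hne
    rw [hsub, Pi.sub_apply, hFx, hGx, ← dist_eq_norm, Nat.dist_cast_real]
    exact Nat.pairwise_one_le_dist hne
  calc μ.real {x | f x ≠ g x} ≤ μ.real {x | 1 ≤ ‖(F - G) x‖} :=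
        ENNReal.toReal_mono (measure_ne_top μ _) (measure_mono_ae hgap)
    _ ≤ ∫ x, ‖(F - G) x‖ ∂μ := by
        simpa only [one_mul] using mul_meas_ge_le_integral_of_nonneg
          (ae_of_all μ fun x => norm_nonneg ((F - G) x)) (L1.integrable_coeFn (F - G)).norm 1
    _ = dist F G := by rw [← L1.norm_eq_integral_norm, dist_eq_norm]

end SequenceEntropy

section Vanishing

variable {X : Type*} [MetricSpace X] [MeasurableSpace X] [BorelSpace X] {T : X → X}
  {μ : Measure X} [IsProbabilityMeasure μ] {a : ℕ → ℕ} {k : ℕ}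

theorem MeasureEquicontinuousAlong.exists_finset_measureReal_ne_lt (hT : MeasurePreserving T μ μ)
    (hequi : MeasureEquicontinuousAlong T μ a) {L : X → Fin k} (hL : Measurable L) {δ : ℝ}
    (hδ : 0 < δ) :
    ∃ F : Finset ℕ, ∀ n, ∃ m ∈ F, μ.real {x | L (T^[a n] x) ≠ L (T^[a m] x)} < δ := by
  have hmeas : Measurable fun x => ((L x : ℕ) : ℝ) :=
    (Measurable.of_discrete (f := fun i : Fin k => ((i : ℕ) : ℝ))).comp hL
  have hmem : MemLp (fun x => ((L x : ℕ) : ℝ)) 1 μ :=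
    MemLp.of_bound hmeas.aestronglyMeasurable k
      (ae_of_all μ fun x => by simp [(L x).is_lt.le])
  obtain ⟨F, hF⟩ := totallyBounded_range_iff.1
    (hequi.totallyBounded_orbit hT ENNReal.one_ne_top (hmem.toLp _)) δ hδ
  refine ⟨F, fun n => (hF n).imp fun m hm => ⟨hm.1, lt_of_le_of_lt ?_ hm.2⟩⟩
  have hcoe (j) := coeFn_iterate_compMeasurePreserving hT hmem.coeFn_toLp (a j)
  simpa only [ne_eq, Fin.val_inj] using measureReal_ne_le_dist
    (f := fun x => L (T^[a n] x)) (g := fun x => L (T^[a m] x)) (hcoe n) (hcoe m)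

theorem MeasureEquicontinuousAlong.exists_fiberEntropy_le_add_mul (hT : MeasurePreserving T μ μ)
    (hequi : MeasureEquicontinuousAlong T μ a) [NeZero k] {L : X → Fin k} (hL : Measurable L)
    {ε : ℝ} (hε : 0 < ε) :
    ∃ C, ∀ n : ℕ, fiberEntropy μ (fun x (i : Fin n) => L (T^[a i] x)) ≤ C + n * ε := by
  obtain ⟨δ, hδ, hsmall⟩ := exists_fiberEntropy_le_of_measureReal_ne_lt μ (0 : Fin k) hε
  obtain ⟨F, hF⟩ := hequi.exists_finset_measureReal_ne_lt hT hL hδ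
  choose c hcF hc using hF
  have hLT (j : ℕ) : Measurable fun x => L (T^[a j] x) := hL.comp (hT.measurable.iterate (a j))
  have hdiff (i : ℕ) : fiberEntropy μ (fun x => L (T^[a i] x) - L (T^[a (c i)] x)) ≤ ε :=
    hsmall _ ((Measurable.of_discrete (f := fun w : Fin k × Fin k => w.1 - w.2)).comp
      ((hLT i).prodMk (hLT (c i)))) (by simpa only [ne_eq, sub_eq_zero] using hc i)
  refine ⟨fiberEntropy μ fun x (m : F) => L (T^[a m] x), fun n => ?_⟩
  calc fiberEntropy μ (fun x (i : Fin n) => L (T^[a i] x))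
      ≤ fiberEntropy μ (fun x (m : F) => L (T^[a m] x)) +
          ∑ i : Fin n, fiberEntropy μ (fun x => L (T^[a i] x) - L (T^[a (c i)] x)) :=
        fiberEntropy_pi_le_add_sum_sub (fun i : Fin n => hLT i) (fun m : F => hLT m)
          fun i => ⟨c i, hcF i⟩
    _ ≤ fiberEntropy μ (fun x (m : F) => L (T^[a m] x)) + n * ε := by
        gcongr
        simpa using Finset.sum_le_card_nsmul Finset.univ _ ε fun (i : Fin n) _ => hdiff i

theorem MeasureEquicontinuousAlong.seqEntropyOf_eq_zero (hT : MeasurePreserving T μ μ)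
    (hequi : MeasureEquicontinuousAlong T μ a) {ξ : Fin k → Set X}
    (hξ : IsMeasurablePartition ξ) : seqEntropyOf T μ a ξ = 0 := by
  obtain ⟨L, hL, hLξ⟩ := hξ.exists_measurable_label
  obtain ⟨x₀⟩ := nonempty_of_isProbabilityMeasure μ
  have : NeZero k := ⟨(Fin.pos (L x₀)).ne'⟩
  have hrate := tendsto_one_div_mul_of_forall_le (fun n => fiberEntropy_nonneg (μ := μ) _)
    fun ε hε => hequi.exists_fiberEntropy_le_add_mul hT hL hε
  simp only [seqEntropyOf, partitionEntropy_joinAlong hLξ]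
  exact ((continuous_coe_real_ereal.tendsto 0).comp hrate).limsup_eq

theorem MeasureEquicontinuousAlong.seqEntropy_eq_zero (hT : MeasurePreserving T μ μ)
    (hequi : MeasureEquicontinuousAlong T μ a) : seqEntropy T μ a = 0 := by
  refine le_antisymm (iSup₂_le fun k ξ => iSup_le fun hξ => ?_) ?_
  · exact (hequi.seqEntropyOf_eq_zero hT hξ).le
  · have htrivial : IsMeasurablePartition fun _ : Fin 1 => (Set.univ : Set X) :=
      isMeasurablePartition_univ
    rw [← hequi.seqEntropyOf_eq_zero hT htrivial]
    exact le_iSup₂_of_le 1 _ (le_iSup_of_le htrivial le_rfl)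

end Vanishing

end MeasureRigidity

theorem theorem3p5_general {X : Type*} [MetricSpace X] [SecondCountableTopology X]
    [MeasurableSpace X] [BorelSpace X] {T : X → X} {μ : Measure X} [IsProbabilityMeasure μ]
    (hT : MeasurePreserving T μ μ) {a : ℕ → ℕ} (ha : MeasureRigidity.IsSubseqNat a)
    (hequi : MeasureRigidity.MeasureEquicontinuousAlong T μ a) :
    (∀ s : ℕ → ℕ, MeasureRigidity.IsSubseqOf s a → MeasureRigidity.seqEntropy T μ s = 0) ∧
      MeasureRigidity.IsRigid hT := by
  refine ⟨?_, hequi.isRigid hT ha⟩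
  rintro _ ⟨φ, -, rfl⟩
  exact (hequi.comp φ).seqEntropy_eq_zero hT

theorem theorem3p5 {X : Type*} [MetricSpace X] [CompactSpace X] [Nonempty X]
    [MeasurableSpace X] [BorelSpace X] (T : X ≃ₜ X)
    (μ : Measure X) [IsProbabilityMeasure μ] (hT : MeasurePreserving T μ μ)
    (a : ℕ → ℕ) (ha : MeasureRigidity.IsSubseqNat a)
    (hequi : MeasureRigidity.MeasureEquicontinuousAlong T μ a) :
    (∀ s : ℕ → ℕ, MeasureRigidity.IsSubseqOf s a → MeasureRigidity.seqEntropy T μ s = 0) ∧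
      MeasureRigidity.IsRigid hT :=
  theorem3p5_general hT ha hequi
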